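/- Let $(a_n)_{n\ge 0}$ be a sequence of non-negative real numbers such that $$1=a_0\ge a_1\ge a_2\ge\cdots,\qquad a_i-2a_{i+1}+a_{i+2}\ge 0\quad(i\ge 0).$$ Let $T$ be the shift on $X=\{0,1\}^{\mathbb N}$. For a finite word $w$ over $\{0,1\}$ let $[w]\subset X$ be the cylinder of sequences beginning with $w$, and for a Borel probability measure $\mu$ on $X$ write $p_w=\mu([w])$. Let $0^n$ be the word consisting of $n$ zeros ($0^0$ being the empty word), and call the words $0^n$, $n\ge 0$, blocks of zeros. Put $h(x)=-x\log x$ for $x>0$ and $h(0)=0$, and let $h_\nu$ denote the Kolmogorov–Sinai entropy of $T$ with respect to a $T$-invariant Borel probability measure $\nu$. Then there exists a $T$-invariant Borel probability measure $\mu$ on $X$ with $\mu([0^n])=a_n$ for all $n\ge 1$ such that: (i) for every word $w$ that is not a block of zeros, $$p_{\varepsilon w\varepsilon'}=\frac{p_{\varepsilon w}\,p_{w\varepsilon'}}{p_w}\qquad(\varepsilon,\varepsilon'\in\{0,1\}),$$ where the right-hand side is read as $0$ if $p_w=0$; and for all $n\ge 0$, $$p_{00^n0}=a_{n+2},\quad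 p_{00^n1}=p_{10^n0}=a_{n+1}-a_{n+2},\quad p_{10^n1}=a_n-2a_{n+1}+a_{n+2};$$ (ii) $\mu$ is the only Borel probability measure on $X$ satisfying all the relations in (i); (iii) $\mu$ is the unique measure of maximal entropy among the $T$-invariant Borel probability measures $\nu$ on $X$ with $\nu([0^n])=a_n$ for all $n\ge 1$: every such $\nu$ satisfies $h_\nu\le h_\mu$, with equality only if $\nu=\mu$; (iv) the series $\sum_{j\ge 0}h(a_j-2a_{j+1}+a_{j+2})$ converges and $$h_\mu=-h(1-a_1)+\sum_{j=0}^{\infty}h(a_j-2a_{j+1}+a_{j+2}).$$ -/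

import Mathlib

open MeasureTheory

noncomputable section

namespace ZeroBlocks

/-- Shannon entropy `H(ξ) = ∑_i -μ(ξ = i) log μ(ξ = i)` (natural logarithm, `0 log 0 = 0`) of the
finite partition of `Ω` into the fibres of `ξ`. -/
def partitionEntropy {Ω ι : Type*} [MeasurableSpace Ω] [Fintype ι] (μ : Measure Ω) (ξ : Ω → ι) :
    ℝ :=
  ∑ i, Real.negMulLog (μ.real (ξ ⁻¹' {i}))

/-- The partition `ξ ∨ T⁻¹ξ ∨ ⋯ ∨ T^{-(n-1)}ξ`, as the map sending a point to its itinerary. -/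
def itinerary {Ω ι : Type*} (T : Ω → Ω) (ξ : Ω → ι) (n : ℕ) (x : Ω) : Fin n → ι :=
  fun i => ξ (T^[(i : ℕ)] x)

/-- Entropy `h_μ(T, ξ) = lim_n (1/n) H(ξ ∨ ⋯ ∨ T^{-(n-1)}ξ)` of `T` relative to a finite partition.
For a `T`-invariant probability measure the limit exists, so the limsup is the limit. -/
def entropyOfPartition {Ω ι : Type*} [MeasurableSpace Ω] [Fintype ι] (T : Ω → Ω)
    (μ : Measure Ω) (ξ : Ω → ι) : EReal :=
  Filter.limsup (fun n : ℕ => ((partitionEntropy μ (itinerary T ξ n) / n : ℝ) : EReal))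
    Filter.atTop

/-- Kolmogorov–Sinai (measure-theoretic) entropy: the supremum of `h_μ(T, ξ)` over all finite
measurable partitions `ξ`. -/
def ksEntropy {Ω : Type*} [MeasurableSpace Ω] (T : Ω → Ω) (μ : Measure Ω) : EReal :=
  ⨆ (k : ℕ) (ξ : Ω → Fin k) (_ : Measurable ξ), entropyOfPartition T μ ξ

/-- The symbolic space `{0,1}^ℕ`, with its product (= Borel) σ-algebra. -/
abbrev Seq : Type := ℕ → Fin 2

/-- The shift transformation. -/
def shift (x : Seq) : Seq := fun n => x (n + 1)

/-- The cylinder `[w]` of sequences beginning with the word `w`. -/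
def cylinder (w : List (Fin 2)) : Set Seq := {x | ∀ i : Fin w.length, x i = w.get i}

/-- The block `0^n` (the empty word for `n = 0`). -/
def zeros (n : ℕ) : List (Fin 2) := List.replicate n 0

/-- Shift-invariant Borel probability measures `ν` on `{0,1}^ℕ` with `ν([0^n]) = a_n`, `n ≥ 1`. -/
def invMeasures (a : ℕ → ℝ) : Set (Measure Seq) :=
  {ν | IsProbabilityMeasure ν ∧ MeasurePreserving shift ν ν ∧
    ∀ n, 1 ≤ n → ν.real (cylinder (zeros n)) = a n}

/-- The values on the blocks `ε 0^n ε'`, `n ≥ 0`. -/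
def ZeroBlockValues (a : ℕ → ℝ) (μ : Measure Seq) : Prop :=
  ∀ n : ℕ,
    μ.real (cylinder (0 :: (zeros n ++ [0]))) = a (n + 2) ∧
    μ.real (cylinder (0 :: (zeros n ++ [1]))) = a (n + 1) - a (n + 2) ∧
    μ.real (cylinder (1 :: (zeros n ++ [0]))) = a (n + 1) - a (n + 2) ∧
    μ.real (cylinder (1 :: (zeros n ++ [1]))) = a n - 2 * a (n + 1) + a (n + 2)

/-- The recursion `p_{εwε'} = p_{εw} p_{wε'} / p_w` for every word `w` that is not a block of
zeros (the empty word is the block `0^0`); the quotient is `0` when `p_w = 0`. -/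
def Recursion (μ : Measure Seq) : Prop :=
  ∀ w : List (Fin 2), (∀ n, w ≠ zeros n) → ∀ ε ε' : Fin 2,
    μ.real (cylinder (ε :: (w ++ [ε']))) =
      μ.real (cylinder (ε :: w)) * μ.real (cylinder (w ++ [ε'])) / μ.real (cylinder w)

end ZeroBlocks

end

/-!
For a shift-invariant measure, the entropies of the partitions into words of length `n` have
increments whose decrease is a sum of conditional mutual informations: every word `w` of length `n`
contributes that of the two letters surrounding it. The contribution of `w = 0^n` is prescribed by
the sequence `a`; up to boundary terms which telescope and tend to `0`, it is `-h(d_n)` with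
`d_n = a_n - 2 a_{n+1} + a_{n+2}`. Any other contribution is nonnegative, and vanishes exactly when
the recursion holds at `w`. The partition by the first letter generates, so the limit of the
increments is the entropy of the shift: it equals `-h(1 - a_1) + ∑ h(d_n)` minus the total
contribution of the words that are not blocks of zeros. Hence the maximum is attained exactly by
the measures satisfying the recursion, and these agree on all cylinders.

Such a measure exists: take the stationary renewal process whose renewals are the letters `1` and
whose waiting times have the tails `(a_n - a_{n+1}) / (1 - a_1)`. Cylinder probabilities factor at
each `1`, which is the recursion, and convexity of `a` says that these tails are decreasing.
-/

namespace ZeroBlocks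

open Real Filter Topology InformationTheory

section MutualInformation

variable {α β : Type*} [Fintype α] [Fintype β] {p : α → β → ℝ}

/-- The mutual information of a finite array of weights. The total mass need not be `1`; its
contribution is subtracted so that arrays of product form have mutual information `0`. -/
noncomputable def mutualInfo (p : α → β → ℝ) : ℝ :=
  ∑ i, negMulLog (∑ j, p i j) + ∑ j, negMulLog (∑ i, p i j)
    - ∑ i, ∑ j, negMulLog (p i j) - negMulLog (∑ i, ∑ j, p i j)

/-- The array of product form with the same marginals as `p`. -/
noncomputable def marginalProduct (p : α → β → ℝ) (i : α) (j : β) : ℝ :=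
  (∑ j', p i j') * (∑ i', p i' j) / ∑ i', ∑ j', p i' j'

lemma sum_marginalProduct (p : α → β → ℝ) :
    ∑ i, ∑ j, marginalProduct p i j = ∑ i, ∑ j, p i j := by
  simp_rw [marginalProduct, ← Finset.sum_div, ← Finset.mul_sum, ← Finset.sum_mul]
  rw [Finset.sum_comm (f := fun j i => p i j), mul_self_div_self]

lemma marginals_pos (hp : ∀ i j, 0 ≤ p i j) {i : α} {j : β} (hij : 0 < p i j) :
    0 < ∑ j', p i j' ∧ 0 < ∑ i', p i' j ∧ 0 < ∑ i', ∑ j', p i' j' := by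
  have hrow : 0 < ∑ j', p i j' :=
    Finset.sum_pos' (fun j' _ => hp i j') ⟨j, Finset.mem_univ j, hij⟩
  exact ⟨hrow, Finset.sum_pos' (fun i' _ => hp i' j) ⟨i, Finset.mem_univ i, hij⟩,
    Finset.sum_pos' (fun i' _ => Finset.sum_nonneg fun j' _ => hp i' j')
      ⟨i, Finset.mem_univ i, hrow⟩⟩

lemma marginalProduct_nonneg (hp : ∀ i j, 0 ≤ p i j) (i : α) (j : β) :
    0 ≤ marginalProduct p i j :=
  div_nonneg (mul_nonneg (Finset.sum_nonneg fun j' _ => hp i j')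
    (Finset.sum_nonneg fun i' _ => hp i' j))
    (Finset.sum_nonneg fun i' _ => Finset.sum_nonneg fun j' _ => hp i' j')

lemma marginalProduct_mul_klFun (hp : ∀ i j, 0 ≤ p i j) (i : α) (j : β) :
    marginalProduct p i j * klFun (p i j / marginalProduct p i j) =
      p i j * (log (p i j) + log (∑ i', ∑ j', p i' j') - log (∑ j', p i j')
        - log (∑ i', p i' j)) + (marginalProduct p i j - p i j) := by
  rcases (hp i j).eq_or_lt with hij | hij
  · simp [← hij, klFun_apply]
  obtain ⟨hrow, hcol, htotal⟩ := marginals_pos hp hij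
  have hprod : 0 < marginalProduct p i j := by unfold marginalProduct; positivity
  have hlog : log (p i j / marginalProduct p i j) = log (p i j) + log (∑ i', ∑ j', p i' j')
      - log (∑ j', p i j') - log (∑ i', p i' j) := by
    rw [log_div hij.ne' hprod.ne', marginalProduct, log_div (by positivity) htotal.ne',
      log_mul hrow.ne' hcol.ne']
    ring
  rw [klFun_apply, hlog]
  field_simp
  ring

lemma mutualInfo_eq_sum_mul_klFun (hp : ∀ i j, 0 ≤ p i j) :
    mutualInfo p = ∑ i, ∑ j,
      marginalProduct p i j * klFun (p i j / marginalProduct p i j) := by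
  have hrow : ∑ i, negMulLog (∑ j, p i j) = -∑ i, ∑ j, p i j * log (∑ j', p i j') := by
    simp_rw [← Finset.sum_mul, negMulLog, neg_mul, Finset.sum_neg_distrib]
  have hcol : ∑ j, negMulLog (∑ i, p i j) = -∑ i, ∑ j, p i j * log (∑ i', p i' j) := by
    rw [Finset.sum_comm]
    simp_rw [← Finset.sum_mul, negMulLog, neg_mul, Finset.sum_neg_distrib]
  have htotal : negMulLog (∑ i, ∑ j, p i j) = -∑ i, ∑ j, p i j * log (∑ i', ∑ j', p i' j') := by
    simp_rw [← Finset.sum_mul, negMulLog, neg_mul]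
  simp_rw [marginalProduct_mul_klFun hp, mul_sub, mul_add, Finset.sum_add_distrib,
    Finset.sum_sub_distrib, Finset.sum_add_distrib]
  rw [sum_marginalProduct, mutualInfo, hrow, hcol, htotal]
  simp only [negMulLog, neg_mul, Finset.sum_neg_distrib]
  ring

lemma marginalProduct_mul_klFun_nonneg (hp : ∀ i j, 0 ≤ p i j) (i : α) (j : β) :
    0 ≤ marginalProduct p i j * klFun (p i j / marginalProduct p i j) :=
  mul_nonneg (marginalProduct_nonneg hp i j)
    (klFun_nonneg (div_nonneg (hp i j) (marginalProduct_nonneg hp i j)))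

lemma mutualInfo_nonneg (hp : ∀ i j, 0 ≤ p i j) : 0 ≤ mutualInfo p := by
  rw [mutualInfo_eq_sum_mul_klFun hp]
  exact Finset.sum_nonneg fun i _ => Finset.sum_nonneg fun j _ =>
    marginalProduct_mul_klFun_nonneg hp i j

lemma marginalProduct_mul_klFun_eq_zero_iff (hp : ∀ i j, 0 ≤ p i j) {i : α} {j : β} :
    marginalProduct p i j * klFun (p i j / marginalProduct p i j) = 0 ↔
      p i j = marginalProduct p i j := by
  by_cases hprod : marginalProduct p i j = 0
  · have hij : p i j = 0 := by
      by_contra hij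
      obtain ⟨hrow, hcol, htotal⟩ := marginals_pos hp ((hp i j).lt_of_ne' hij)
      exact (div_pos (mul_pos hrow hcol) htotal).ne' hprod
    simp [hprod, hij]
  · rw [mul_eq_zero_iff_left hprod, klFun_eq_zero_iff
      (div_nonneg (hp i j) (marginalProduct_nonneg hp i j)), div_eq_one_iff_eq hprod]

lemma mutualInfo_eq_zero_iff (hp : ∀ i j, 0 ≤ p i j) :
    mutualInfo p = 0 ↔ ∀ i j, p i j = marginalProduct p i j := by
  have hterm := marginalProduct_mul_klFun_nonneg hp
  rw [mutualInfo_eq_sum_mul_klFun hp,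
    Finset.sum_eq_zero_iff_of_nonneg fun i _ => Finset.sum_nonneg fun j _ => hterm i j]
  simp only [Finset.mem_univ, true_implies,
    Finset.sum_eq_zero_iff_of_nonneg fun j _ => hterm _ j,
    marginalProduct_mul_klFun_eq_zero_iff hp]

end MutualInformation

lemma negMulLog_sum_le {α : Type*} {s : Finset α} {q : α → ℝ} (hq : ∀ i, 0 ≤ q i) :
    negMulLog (∑ i ∈ s, q i) ≤ ∑ i ∈ s, negMulLog (q i) := by
  rw [negMulLog, neg_mul, Finset.sum_mul, ← Finset.sum_neg_distrib]
  refine Finset.sum_le_sum fun i hi => ?_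
  rw [negMulLog, neg_mul, neg_le_neg_iff]
  rcases (hq i).eq_or_lt with hqi | hqi
  · simp [← hqi]
  · gcongr
    exact Finset.single_le_sum (fun i _ => hq i) hi

section PartitionEntropy

variable {Ω ι κ τ : Type*} [MeasurableSpace Ω] [Fintype ι] [Fintype κ] [Fintype τ]
  {μ : Measure Ω}

lemma partitionEntropy_equiv_comp (μ : Measure Ω) (e : ι ≃ κ) (X : Ω → ι) :
    partitionEntropy μ (fun x => e (X x)) = partitionEntropy μ X := by
  refine (e.sum_comp _).symm.trans (Finset.sum_congr rfl fun i _ => ?_)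
  congr 2
  ext x
  simp

variable [MeasurableSpace ι] [MeasurableSingletonClass ι] [MeasurableSpace κ]
  [MeasurableSingletonClass κ] {X : Ω → ι} {Y : Ω → κ}

lemma partitionEntropy_comp_measurePreserving (hX : Measurable X) {T : Ω → Ω}
    (hT : MeasurePreserving T μ μ) :
    partitionEntropy μ (fun x => X (T x)) = partitionEntropy μ X := by
  refine Finset.sum_congr rfl fun i _ => congrArg _ ?_
  exact hT.measureReal_preimage (hX (measurableSet_singleton i)).nullMeasurableSet

variable [IsFiniteMeasure μ]

lemma measureReal_eq_sum_inter_fiber (hX : Measurable X) (A : Set Ω) :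
    μ.real A = ∑ i, μ.real (A ∩ X ⁻¹' {i}) := by
  have h := sum_measureReal_preimage_singleton (μ := μ.restrict A) Finset.univ (f := X)
    fun i _ => hX (measurableSet_singleton i)
  simp only [Finset.coe_univ, Set.preimage_univ, measureReal_restrict_apply_univ,
    measureReal_restrict_apply (hX (measurableSet_singleton _))] at h
  simp_rw [← h, Set.inter_comm A]

lemma partitionEntropy_comp_le (hX : Measurable X) (f : ι → τ) :
    partitionEntropy μ (fun x => f (X x)) ≤ partitionEntropy μ X := by
  classical
  have hfiber (t : τ) :
      μ.real ((fun x => f (X x)) ⁻¹' {t}) = ∑ i with f i = t, μ.real (X ⁻¹' {i}) := by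
    rw [sum_measureReal_preimage_singleton _ fun i _ => hX (measurableSet_singleton i)]
    congr 1
    ext x
    simp
  calc partitionEntropy μ (fun x => f (X x))
      = ∑ t, negMulLog (∑ i with f i = t, μ.real (X ⁻¹' {i})) := by
        simp only [partitionEntropy, hfiber]
    _ ≤ ∑ t, ∑ i with f i = t, negMulLog (μ.real (X ⁻¹' {i})) :=
        Finset.sum_le_sum fun t _ => negMulLog_sum_le fun i => measureReal_nonneg
    _ = partitionEntropy μ X := Finset.sum_fiberwise _ _ _

lemma partitionEntropy_add_sub_eq_sum_mutualInfo (hX : Measurable X) (hY : Measurable Y)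
    (Z : Ω → τ) :
    partitionEntropy μ (fun x => (X x, Z x)) + partitionEntropy μ (fun x => (Y x, Z x))
        - partitionEntropy μ (fun x => (X x, Y x, Z x)) - partitionEntropy μ Z =
      ∑ z, mutualInfo fun i j => μ.real ((fun x => (X x, Y x, Z x)) ⁻¹' {(i, j, z)}) := by
  have hXZ (i : ι) (z : τ) : μ.real ((fun x => (X x, Z x)) ⁻¹' {(i, z)}) =
      ∑ j, μ.real ((fun x => (X x, Y x, Z x)) ⁻¹' {(i, j, z)}) := by
    rw [measureReal_eq_sum_inter_fiber hY]
    exact Finset.sum_congr rfl fun j _ => congrArg _ (by ext x; simp; tauto)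
  have hYZ (j : κ) (z : τ) : μ.real ((fun x => (Y x, Z x)) ⁻¹' {(j, z)}) =
      ∑ i, μ.real ((fun x => (X x, Y x, Z x)) ⁻¹' {(i, j, z)}) := by
    rw [measureReal_eq_sum_inter_fiber hX]
    exact Finset.sum_congr rfl fun i _ => congrArg _ (by ext x; simp; tauto)
  have hZ (z : τ) : μ.real (Z ⁻¹' {z}) =
      ∑ i, ∑ j, μ.real ((fun x => (X x, Y x, Z x)) ⁻¹' {(i, j, z)}) := by
    simp_rw [← hXZ]
    rw [measureReal_eq_sum_inter_fiber hX]
    exact Finset.sum_congr rfl fun i _ => congrArg _ (by ext x; simp; tauto)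
  simp only [partitionEntropy, hXZ, hYZ, hZ, Fintype.sum_prod_type_right, mutualInfo,
    Finset.sum_sub_distrib, Finset.sum_add_distrib]
  rw [Finset.sum_congr rfl fun z _ => Finset.sum_comm]

lemma partitionEntropy_strong_subadditivity (hX : Measurable X) (hY : Measurable Y)
    (Z : Ω → τ) :
    partitionEntropy μ (fun x => (X x, Y x, Z x)) + partitionEntropy μ Z ≤
      partitionEntropy μ (fun x => (X x, Z x)) + partitionEntropy μ (fun x => (Y x, Z x)) := by
  have h := partitionEntropy_add_sub_eq_sum_mutualInfo (μ := μ) hX hY Z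
  have hnonneg := Finset.sum_nonneg fun z (_ : z ∈ Finset.univ) => mutualInfo_nonneg
    (p := fun i j => μ.real ((fun x => (X x, Y x, Z x)) ⁻¹' {(i, j, z)}))
    fun i j => measureReal_nonneg
  linarith

end PartitionEntropy

section ConditionalEntropy

variable {Ω ι κ τ : Type*} [MeasurableSpace Ω] [Fintype ι] [Fintype κ] [Fintype τ]
  {μ : Measure Ω}

/-- The conditional entropy `H(X | Y)` of two finite partitions. -/
noncomputable def condPartitionEntropy (μ : Measure Ω) (X : Ω → ι) (Y : Ω → κ) : ℝ :=
  partitionEntropy μ (fun x => (X x, Y x)) - partitionEntropy μ Y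

variable [MeasurableSpace ι] [MeasurableSingletonClass ι] [MeasurableSpace κ]
  [MeasurableSingletonClass κ] {X : Ω → ι} {Y : Ω → κ}

lemma condPartitionEntropy_comp_measurePreserving (hX : Measurable X) (hY : Measurable Y)
    {T : Ω → Ω} (hT : MeasurePreserving T μ μ) :
    condPartitionEntropy μ (fun x => X (T x)) (fun x => Y (T x)) =
      condPartitionEntropy μ X Y := by
  rw [condPartitionEntropy, partitionEntropy_comp_measurePreserving hY hT,
    partitionEntropy_comp_measurePreserving (hX.prodMk hY) hT, condPartitionEntropy]

variable [IsFiniteMeasure μ]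

lemma condPartitionEntropy_prod_le (hX : Measurable X) (hY : Measurable Y) (Z : Ω → τ) :
    condPartitionEntropy μ (fun x => (X x, Y x)) Z ≤
      condPartitionEntropy μ X Z + condPartitionEntropy μ Y Z := by
  have hssa := partitionEntropy_strong_subadditivity (μ := μ) hX hY Z
  have hassoc := partitionEntropy_equiv_comp μ (Equiv.prodAssoc ι κ τ)
    fun x => ((X x, Y x), Z x)
  simp only [Equiv.prodAssoc_apply] at hassoc
  unfold condPartitionEntropy
  linarith

lemma partitionEntropy_le_add_condPartitionEntropy (hX : Measurable X) (hY : Measurable Y) :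
    partitionEntropy μ X ≤ partitionEntropy μ Y + condPartitionEntropy μ X Y := by
  have hforget := partitionEntropy_comp_le (μ := μ) (hX.prodMk hY) Prod.fst
  unfold condPartitionEntropy
  linarith

lemma condPartitionEntropy_le_comp [MeasurableSpace τ] [MeasurableSingletonClass τ]
    (hX : Measurable X) (hY : Measurable Y) (f : κ → τ) :
    condPartitionEntropy μ X Y ≤ condPartitionEntropy μ X (fun x => f (Y x)) := by
  have hZ : Measurable fun x => f (Y x) := (Measurable.of_discrete (f := f)).comp hY
  have hssa := partitionEntropy_strong_subadditivity (μ := μ) hX hY fun x => f (Y x)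
  have hforget : partitionEntropy μ (fun x => (X x, Y x)) ≤
      partitionEntropy μ (fun x => (X x, Y x, f (Y x))) :=
    partitionEntropy_comp_le (hX.prodMk (hY.prodMk hZ)) fun q => (q.1, q.2.1)
  have hgraph : partitionEntropy μ (fun x => (Y x, f (Y x))) ≤ partitionEntropy μ Y :=
    partitionEntropy_comp_le hY fun j => (j, f j)
  unfold condPartitionEntropy
  linarith

end ConditionalEntropy

section Itinerary

variable {Ω ι κ : Type*} {T : Ω → Ω}

lemma itinerary_succ_eq_cons (ξ : Ω → ι) (n : ℕ) (x : Ω) :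
    itinerary T ξ (n + 1) x = Fin.cons (ξ x) (itinerary T ξ n (T x)) := by
  ext i
  refine Fin.cases ?_ (fun i => ?_) i <;> simp [itinerary]

lemma itinerary_succ_eq_snoc (ξ : Ω → ι) (n : ℕ) (x : Ω) :
    itinerary T ξ (n + 1) x = Fin.snoc (itinerary T ξ n x) (ξ (T^[n] x)) := by
  ext i
  refine Fin.lastCases ?_ (fun i => ?_) i <;> simp [itinerary]

variable [MeasurableSpace Ω] {μ : Measure Ω}

/-- The entropy `H(ξ ∨ T⁻¹ξ ∨ ⋯ ∨ T^{-(n-1)}ξ)` of the partition into itineraries of length `n`. -/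
noncomputable def itineraryEntropy [Fintype ι] (T : Ω → Ω) (μ : Measure Ω) (ξ : Ω → ι) (n : ℕ) :
    ℝ :=
  partitionEntropy μ (itinerary T ξ n)

lemma measurable_itinerary [MeasurableSpace ι] {ξ : Ω → ι} (hT : Measurable T)
    (hξ : Measurable ξ) (n : ℕ) : Measurable (itinerary T ξ n) :=
  measurable_pi_lambda _ fun i => hξ.comp (hT.iterate i)

variable [Fintype ι] [MeasurableSpace ι] [MeasurableSingletonClass ι] [Fintype κ]
  [MeasurableSpace κ] [MeasurableSingletonClass κ] [IsFiniteMeasure μ] {ξ : Ω → ι} {η : Ω → κ}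

lemma itineraryEntropy_second_difference (hT : MeasurePreserving T μ μ)
    (hξ : Measurable ξ) (n : ℕ) :
    2 * itineraryEntropy T μ ξ (n + 1) - itineraryEntropy T μ ξ (n + 2)
        - itineraryEntropy T μ ξ n =
      ∑ v : Fin n → ι, mutualInfo fun i j =>
        μ.real (itinerary T ξ (n + 2) ⁻¹' {Fin.cons i (Fin.snoc v j)}) := by
  let Y : Ω → ι := fun x => ξ (T^[n] (T x))
  let Z : Ω → Fin n → ι := fun x => itinerary T ξ n (T x)
  have hY : Measurable Y := hξ.comp ((hT.measurable.iterate n).comp hT.measurable)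
  have hitin := measurable_itinerary hT.measurable hξ
  have hjoint (x : Ω) : itinerary T ξ (n + 2) x = Fin.cons (ξ x) (Fin.snoc (Z x) (Y x)) := by
    rw [itinerary_succ_eq_cons, itinerary_succ_eq_snoc]
  have hZ : partitionEntropy μ Z = itineraryEntropy T μ ξ n :=
    partitionEntropy_comp_measurePreserving (hitin n) hT
  have hXZ : partitionEntropy μ (fun x => (ξ x, Z x)) =
      itineraryEntropy T μ ξ (n + 1) := by
    rw [← partitionEntropy_equiv_comp μ (Fin.consEquiv fun _ => ι)]
    exact congrArg _ (funext fun x => (itinerary_succ_eq_cons ξ n x).symm)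
  have hYZ : partitionEntropy μ (fun x => (Y x, Z x)) =
      itineraryEntropy T μ ξ (n + 1) := by
    rw [← partitionEntropy_equiv_comp μ (Fin.snocEquiv fun _ => ι), itineraryEntropy,
      ← partitionEntropy_comp_measurePreserving (hitin (n + 1)) hT]
    exact congrArg _ (funext fun x => (itinerary_succ_eq_snoc ξ n (T x)).symm)
  have hXYZ : partitionEntropy μ (fun x => (ξ x, Y x, Z x)) =
      itineraryEntropy T μ ξ (n + 2) := by
    rw [← partitionEntropy_equiv_comp μ ((Equiv.prodCongrRight fun _ : ι =>
      Fin.snocEquiv fun _ => ι).trans (Fin.consEquiv fun _ => ι))]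
    exact congrArg _ (funext fun x => (hjoint x).symm)
  have h := partitionEntropy_add_sub_eq_sum_mutualInfo (μ := μ) hξ hY Z
  rw [hXZ, hYZ, hXYZ, hZ, ← two_mul] at h
  rw [h]
  refine Finset.sum_congr rfl fun v _ => congrArg _ (funext₂ fun i j => congrArg _ ?_)
  ext x
  simp [hjoint, Fin.cons_inj, Fin.snoc_inj, and_comm]

lemma antitone_itineraryEntropy_increment (hT : MeasurePreserving T μ μ)
    (hξ : Measurable ξ) :
    Antitone fun n => itineraryEntropy T μ ξ (n + 1)
      - itineraryEntropy T μ ξ n := by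
  refine antitone_nat_of_succ_le fun n => ?_
  have hconcave : 0 ≤ 2 * itineraryEntropy T μ ξ (n + 1)
      - itineraryEntropy T μ ξ (n + 2) - itineraryEntropy T μ ξ n := by
    rw [itineraryEntropy_second_difference hT hξ]
    exact Finset.sum_nonneg fun v _ => mutualInfo_nonneg fun i j => measureReal_nonneg
  rw [add_assoc, one_add_one_eq_two]
  linarith

lemma itineraryEntropy_le_succ (hT : Measurable T) (hξ : Measurable ξ) (n : ℕ) :
    itineraryEntropy T μ ξ n ≤ itineraryEntropy T μ ξ (n + 1) := by
  have hforget := partitionEntropy_comp_le (μ := μ) (measurable_itinerary hT hξ (n + 1)) Fin.init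
  simp only [itinerary_succ_eq_snoc ξ n, Fin.init_snoc] at hforget
  exact hforget

lemma condPartitionEntropy_itinerary_le_sum (hT : Measurable T) (hξ : Measurable ξ)
    (hη : Measurable η) (n : ℕ) :
    condPartitionEntropy μ (itinerary T ξ n) η ≤
      ∑ m ∈ Finset.range n, condPartitionEntropy μ (fun x => ξ (T^[m] x)) η := by
  induction n with
  | zero =>
    have htrivial := partitionEntropy_comp_le (μ := μ) hη fun k => ((Fin.elim0 : Fin 0 → ι), k)
    simpa [condPartitionEntropy, Subsingleton.elim (itinerary T ξ 0 _) Fin.elim0] using htrivial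
  | succ n ih =>
    have hsplit : condPartitionEntropy μ (itinerary T ξ (n + 1)) η =
        condPartitionEntropy μ (fun x => (ξ (T^[n] x), itinerary T ξ n x)) η := by
      refine congrArg (· - partitionEntropy μ η) ?_
      simp only [itinerary_succ_eq_snoc ξ n]
      exact partitionEntropy_equiv_comp μ ((Fin.snocEquiv fun _ => ι).prodCongr (Equiv.refl κ))
        fun x => ((ξ (T^[n] x), itinerary T ξ n x), η x)
    rw [hsplit, Finset.sum_range_succ, add_comm]
    exact (condPartitionEntropy_prod_le (hξ.comp (hT.iterate n))
      (measurable_itinerary hT hξ n) η).trans (by gcongr; exact le_rfl)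

/-- The map `g` guesses a letter of the `ξ`-itinerary from a window of `N` letters of the
`η`-itinerary; each guess costs at most the conditional entropy. -/
lemma itineraryEntropy_le_add (hT : MeasurePreserving T μ μ) (hξ : Measurable ξ)
    (hη : Measurable η) {N : ℕ} (g : (Fin N → κ) → ι) (n : ℕ) :
    itineraryEntropy T μ ξ n ≤ itineraryEntropy T μ η (n + N) +
      n * condPartitionEntropy μ ξ (fun x => g (itinerary T η N x)) := by
  have hηN := measurable_itinerary hT.measurable hη N
  have hηnN := measurable_itinerary hT.measurable hη (n + N)
  have hg : Measurable fun x => g (itinerary T η N x) :=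
    (Measurable.of_discrete (f := g)).comp hηN
  have hterm (m : ℕ) (hm : m < n) :
      condPartitionEntropy μ (fun x => ξ (T^[m] x)) (itinerary T η (n + N)) ≤
        condPartitionEntropy μ ξ (fun x => g (itinerary T η N x)) := by
    have hwindow (x : Ω) : itinerary T η N (T^[m] x) =
        fun i : Fin N => itinerary T η (n + N) x ⟨i + m, by omega⟩ := by
      ext i
      simp only [itinerary, Function.iterate_add_apply]
    rw [← condPartitionEntropy_comp_measurePreserving hξ hg (hT.iterate m)]
    simp only [hwindow]
    exact condPartitionEntropy_le_comp (hξ.comp (hT.measurable.iterate m)) hηnN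
      fun v => g fun i => v ⟨i + m, by omega⟩
  have hsum := (condPartitionEntropy_itinerary_le_sum hT.measurable hξ hηnN n).trans
    (Finset.sum_le_sum fun m hm => hterm m (Finset.mem_range.1 hm))
  rw [Finset.sum_const, Finset.card_range, nsmul_eq_mul] at hsum
  calc itineraryEntropy T μ ξ n
      ≤ itineraryEntropy T μ η (n + N) +
          condPartitionEntropy μ (itinerary T ξ n) (itinerary T η (n + N)) :=
        partitionEntropy_le_add_condPartitionEntropy
          (measurable_itinerary hT.measurable hξ n) hηnN
    _ ≤ _ := by gcongr

end Itinerary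

section Approximation

variable {Ω ι : Type*} [MeasurableSpace Ω] {μ : Measure Ω} [IsFiniteMeasure μ]

lemma abs_measureReal_fiber_sub_le (X Y : Ω → ι) (i : ι) :
    |μ.real (X ⁻¹' {i}) - μ.real (Y ⁻¹' {i})| ≤ μ.real {x | X x ≠ Y x} := by
  have hle (X Y : Ω → ι) : μ.real (X ⁻¹' {i}) ≤ μ.real (Y ⁻¹' {i}) + μ.real {x | X x ≠ Y x} := by
    refine (measureReal_mono fun x hx => ?_).trans (measureReal_union_le _ _)
    by_cases hxy : X x = Y x
    · exact Or.inl (hxy.symm.trans hx)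
    · exact Or.inr hxy
  have hYX := hle Y X
  simp only [ne_comm (a := Y _)] at hYX
  exact abs_sub_le_iff.2 ⟨sub_le_iff_le_add'.2 (hle X Y), sub_le_iff_le_add'.2 hYX⟩

variable [Fintype ι]

lemma exists_partitionEntropy_sub_lt (ι : Type*) [Fintype ι] (μ : Measure Ω)
    [IsFiniteMeasure μ] {ε : ℝ} (hε : 0 < ε) :
    ∃ δ > 0, ∀ X Y : Ω → ι, μ.real {x | X x ≠ Y x} < δ →
      partitionEntropy μ X - partitionEntropy μ Y < ε := by
  have hcont : Continuous fun p : ι → ℝ => ∑ i, negMulLog (p i) := by fun_prop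
  obtain ⟨δ, hδ, hclose⟩ := Metric.uniformContinuousOn_iff.1
    ((isCompact_Icc (a := (0 : ι → ℝ)) (b := fun _ => μ.real Set.univ)
      ).uniformContinuousOn_of_continuous hcont.continuousOn) ε hε
  have hmem (X : Ω → ι) :
      (fun i => μ.real (X ⁻¹' {i})) ∈ Set.Icc (0 : ι → ℝ) fun _ => μ.real Set.univ :=
    ⟨fun i => measureReal_nonneg, fun i => measureReal_mono (Set.subset_univ _)⟩
  refine ⟨δ, hδ, fun X Y hXY => (le_abs_self _).trans_lt (hclose _ (hmem X) _ (hmem Y) ?_)⟩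
  exact (dist_pi_lt_iff hδ).2 fun i => (abs_measureReal_fiber_sub_le X Y i).trans_lt hXY

lemma exists_condPartitionEntropy_lt (ι : Type*) [Fintype ι] [MeasurableSpace ι]
    [MeasurableSingletonClass ι] (μ : Measure Ω) [IsFiniteMeasure μ] {ε : ℝ} (hε : 0 < ε) :
    ∃ δ > 0, ∀ X Y : Ω → ι, Measurable Y → μ.real {x | X x ≠ Y x} < δ →
      condPartitionEntropy μ X Y < ε := by
  obtain ⟨δ, hδ, hclose⟩ := exists_partitionEntropy_sub_lt (ι × ι) μ hε
  refine ⟨δ, hδ, fun X Y hY hXY => ?_⟩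
  have hdiag : partitionEntropy μ (fun x => (Y x, Y x)) ≤ partitionEntropy μ Y :=
    partitionEntropy_comp_le hY fun i => (i, i)
  have hpair := hclose (fun x => (X x, Y x)) (fun x => (Y x, Y x)) (by simpa using hXY)
  unfold condPartitionEntropy
  linarith

end Approximation

section Generator

variable {Ω κ : Type*} {T : Ω → Ω} {η : Ω → κ}

/-- The events that depend only on finitely many letters of the itinerary. The partition `η` is a
generator for `T` when they generate the σ-algebra. -/
def itineraryEvents (T : Ω → Ω) (η : Ω → κ) : Set (Set Ω) :=
  {A | ∃ n, ∃ S : Set (Fin n → κ), itinerary T η n ⁻¹' S = A}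

lemma exists_itinerary_preimage_eq_of_le {m n : ℕ} (hmn : m ≤ n) (S : Set (Fin m → κ)) :
    ∃ S' : Set (Fin n → κ), itinerary T η n ⁻¹' S' = itinerary T η m ⁻¹' S :=
  ⟨{v | (fun i => v (Fin.castLE hmn i)) ∈ S}, rfl⟩

lemma isSetAlgebra_itineraryEvents (T : Ω → Ω) (η : Ω → κ) :
    IsSetAlgebra (itineraryEvents T η) where
  empty_mem := ⟨0, ∅, rfl⟩
  compl_mem := by
    rintro _ ⟨n, S, rfl⟩
    exact ⟨n, Sᶜ, rfl⟩
  union_mem := by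
    rintro _ _ ⟨m, S, rfl⟩ ⟨n, S', rfl⟩
    obtain ⟨R, hR⟩ := exists_itinerary_preimage_eq_of_le (T := T) (η := η) (le_max_left m n) S
    obtain ⟨R', hR'⟩ := exists_itinerary_preimage_eq_of_le (T := T) (η := η) (le_max_right m n) S'
    exact ⟨max m n, R ∪ R', by rw [Set.preimage_union, hR, hR']⟩

variable {ι : Type*} [mΩ : MeasurableSpace Ω] {μ ν : Measure Ω}

lemma exists_itinerary_decoder [Finite ι] [Nonempty ι] [MeasurableSpace ι]
    [MeasurableSingletonClass ι] [IsFiniteMeasure μ]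
    (hgen : mΩ = MeasurableSpace.generateFrom (itineraryEvents T η)) {ξ : Ω → ι}
    (hξ : Measurable ξ) {δ : ℝ} (hδ : 0 < δ) :
    ∃ N, ∃ g : (Fin N → κ) → ι, μ.real {x | ξ x ≠ g (itinerary T η N x)} < δ := by
  cases nonempty_fintype ι
  have hdense := Measure.MeasureDense.of_generateFrom_isSetAlgebra_finite (μ := μ)
    (isSetAlgebra_itineraryEvents T η) hgen
  have hδ' : 0 < δ / (Fintype.card ι + 1) := by positivity
  choose A hA hAδ using fun i =>
    hdense.approx (ξ ⁻¹' {i}) (hξ (measurableSet_singleton i)) (measure_ne_top _ _) _ hδ'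
  choose n S hS using hA
  choose S' hS' using fun i => exists_itinerary_preimage_eq_of_le (T := T) (η := η)
    (Finset.le_sup (f := n) (Finset.mem_univ i)) (S i)
  -- Off the symmetric differences exactly one `S' i` contains the itinerary, so the arbitrary value
  -- chosen elsewhere is harmless.
  refine ⟨Finset.univ.sup n, fun v => Classical.epsilon fun i => v ∈ S' i, ?_⟩
  have hsub : {x | ξ x ≠ Classical.epsilon fun i => itinerary T η (Finset.univ.sup n) x ∈ S' i} ⊆
      ⋃ i, symmDiff (ξ ⁻¹' {i}) (A i) := by
    intro x hx
    by_contra hgood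
    have hiff (i : ι) : ξ x = i ↔ itinerary T η (Finset.univ.sup n) x ∈ S' i := by
      simp only [Set.mem_iUnion, not_exists, Set.mem_symmDiff, ← hS, ← hS'] at hgood
      have := hgood i
      simp only [Set.mem_preimage, Set.mem_singleton_iff] at this
      tauto
    exact hx ((hiff _).2 (Classical.epsilon_spec (p := fun i => _ ∈ S' i) ⟨ξ x, (hiff _).1 rfl⟩))
  calc μ.real {x | ξ x ≠ Classical.epsilon fun i => itinerary T η (Finset.univ.sup n) x ∈ S' i}
      ≤ ∑ i, μ.real (symmDiff (ξ ⁻¹' {i}) (A i)) :=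
        (measureReal_mono hsub).trans (measureReal_iUnion_fintype_le _)
    _ ≤ ∑ _i : ι, δ / (Fintype.card ι + 1) :=
        Finset.sum_le_sum fun i _ => ENNReal.toReal_le_of_le_ofReal hδ'.le (hAδ i).le
    _ < δ := by
        rw [Finset.sum_const, Finset.card_univ, nsmul_eq_mul, mul_div_assoc',
          div_lt_iff₀ (by positivity)]
        linarith

lemma ext_of_itinerary_generator [Finite κ] [MeasurableSpace κ] [MeasurableSingletonClass κ]
    [IsFiniteMeasure μ] [IsFiniteMeasure ν] (hT : Measurable T) (hη : Measurable η)
    (hgen : mΩ = MeasurableSpace.generateFrom (itineraryEvents T η))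
    (h : ∀ n v, μ.real (itinerary T η n ⁻¹' {v}) = ν.real (itinerary T η n ⁻¹' {v})) :
    μ = ν := by
  classical
  cases nonempty_fintype κ
  have hevent (n : ℕ) (S : Set (Fin n → κ)) :
      μ (itinerary T η n ⁻¹' S) = ν (itinerary T η n ⁻¹' S) := by
    have hfiber v (_ : v ∈ S.toFinset) : MeasurableSet (itinerary T η n ⁻¹' {v}) :=
      measurable_itinerary hT hη n (measurableSet_singleton v)
    rw [← measureReal_eq_measureReal_iff, ← Set.coe_toFinset S,
      ← sum_measureReal_preimage_singleton _ hfiber, ← sum_measureReal_preimage_singleton _ hfiber]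
    exact Finset.sum_congr rfl fun v _ => h n v
  refine ext_of_generate_finite _ hgen
    (isSetAlgebra_itineraryEvents T η).isSetRing.isSetSemiring.isPiSystem ?_ (hevent 0 Set.univ)
  rintro _ ⟨n, S, rfl⟩
  exact hevent n S

variable [Fintype ι]

lemma tendsto_div_of_tendsto_increment {u : ℕ → ℝ} {L : ℝ}
    (hu : Tendsto (fun n => u (n + 1) - u n) atTop (𝓝 L)) (N : ℕ) :
    Tendsto (fun n : ℕ => u (n + N) / n) atTop (𝓝 L) := by
  have hmean := (hu.comp (tendsto_add_atTop_nat N)).cesaro.add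
    (tendsto_const_div_atTop_nhds_zero_nat (u N))
  rw [add_zero] at hmean
  refine hmean.congr fun n => ?_
  have htelescope := Finset.sum_range_sub (fun m => u (m + N)) n
  simp only [Function.comp_apply, zero_add, add_right_comm _ 1 N] at htelescope ⊢
  rw [htelescope]
  ring

lemma entropyOfPartition_eq_of_tendsto_increment {ξ : Ω → ι} {L : ℝ}
    (hL : Tendsto (fun n => itineraryEntropy T μ ξ (n + 1)
      - itineraryEntropy T μ ξ n) atTop (𝓝 L)) :
    entropyOfPartition T μ ξ = L :=
  ((continuous_coe_real_ereal.tendsto L).comp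
    (tendsto_div_of_tendsto_increment hL 0)).limsup_eq

variable [MeasurableSpace ι] [MeasurableSingletonClass ι] [Fintype κ] [MeasurableSpace κ]
  [MeasurableSingletonClass κ]

lemma entropyOfPartition_le_add_condPartitionEntropy [IsFiniteMeasure μ]
    (hT : MeasurePreserving T μ μ) {ξ : Ω → ι}
    (hξ : Measurable ξ) (hη : Measurable η) {L : ℝ}
    (hL : Tendsto (fun n => itineraryEntropy T μ η (n + 1)
      - itineraryEntropy T μ η n) atTop (𝓝 L)) {N : ℕ} (g : (Fin N → κ) → ι) :
    entropyOfPartition T μ ξ ≤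
      ((L + condPartitionEntropy μ ξ fun x => g (itinerary T η N x) : ℝ) : EReal) := by
  have hlim := (tendsto_div_of_tendsto_increment hL N).add_const
    (condPartitionEntropy μ ξ fun x => g (itinerary T η N x))
  refine le_of_le_of_eq (limsup_le_limsup ?_)
    ((continuous_coe_real_ereal.tendsto _).comp hlim).limsup_eq
  filter_upwards [eventually_gt_atTop 0] with n hn
  have hn' : (0 : ℝ) < n := Nat.cast_pos.2 hn
  rw [Function.comp_apply, EReal.coe_le_coe_iff, div_add' _ _ _ hn'.ne']
  gcongr
  exact (itineraryEntropy_le_add hT hξ hη g n).trans_eq (by ring)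

variable [IsProbabilityMeasure μ]

lemma entropyOfPartition_le_of_generator
    (hgen : mΩ = MeasurableSpace.generateFrom (itineraryEvents T η))
    (hT : MeasurePreserving T μ μ) {ξ : Ω → ι} (hξ : Measurable ξ) (hη : Measurable η) {L : ℝ}
    (hL : Tendsto (fun n => itineraryEntropy T μ η (n + 1)
      - itineraryEntropy T μ η n) atTop (𝓝 L)) :
    entropyOfPartition T μ ξ ≤ L := by
  have : Nonempty ι := μ.nonempty_of_neZero.map ξ
  refine EReal.le_of_forall_lt_iff_le.1 fun z hz => ?_
  obtain ⟨δ, hδ, hsmall⟩ :=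
    exists_condPartitionEntropy_lt ι μ (sub_pos.2 (EReal.coe_lt_coe_iff.1 hz))
  obtain ⟨N, g, hg⟩ := exists_itinerary_decoder (μ := μ) hgen hξ hδ
  have hmeas : Measurable fun x => g (itinerary T η N x) :=
    (Measurable.of_discrete (f := g)).comp (measurable_itinerary hT.measurable hη N)
  refine (entropyOfPartition_le_add_condPartitionEntropy hT hξ hη hL g).trans ?_
  rw [EReal.coe_le_coe_iff]
  linarith [hsmall ξ _ hmeas hg]

lemma ksEntropy_eq_of_generator {k : ℕ} {η : Ω → Fin k}
    (hgen : mΩ = MeasurableSpace.generateFrom (itineraryEvents T η))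
    (hT : MeasurePreserving T μ μ) (hη : Measurable η) {L : ℝ}
    (hL : Tendsto (fun n => itineraryEntropy T μ η (n + 1)
      - itineraryEntropy T μ η n) atTop (𝓝 L)) :
    ksEntropy T μ = L := by
  refine le_antisymm (iSup_le fun k => iSup₂_le fun ξ hξ =>
    entropyOfPartition_le_of_generator hgen hT hξ hη hL) ?_
  rw [← entropyOfPartition_eq_of_tendsto_increment hL]
  exact le_iSup_of_le k (le_iSup₂_of_le η hη le_rfl)

end Generator

section Words

/-- The letter at time zero, read as a partition of the symbolic space; it is a generator for the
shift, and the fibres of its itineraries are the cylinders. -/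
def firstLetter (x : Seq) : Fin 2 := x 0

lemma mem_cylinder_iff {w : List (Fin 2)} {x : Seq} :
    x ∈ cylinder w ↔ ∀ i (h : i < w.length), x i = w[i] :=
  ⟨fun hx i h => hx ⟨i, h⟩, fun hx i => hx i i.2⟩

lemma cylinder_nil : cylinder [] = Set.univ :=
  Set.eq_univ_of_forall fun _ => mem_cylinder_iff.2 fun _ h => absurd h (Nat.not_lt_zero _)

lemma cylinder_cons (ε : Fin 2) (w : List (Fin 2)) :
    cylinder (ε :: w) = shift ⁻¹' cylinder w ∩ firstLetter ⁻¹' {ε} := by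
  ext x
  simp only [Set.mem_inter_iff, Set.mem_preimage, mem_cylinder_iff, Set.mem_singleton_iff]
  constructor
  · intro h
    exact ⟨fun i hi => h (i + 1) (by simpa using hi), h 0 (by simp)⟩
  · rintro ⟨h, h0⟩ (_ | i) hi
    · exact h0
    · exact h i (by simpa using hi)

lemma cylinder_concat (w : List (Fin 2)) (ε : Fin 2) :
    cylinder (w ++ [ε]) = cylinder w ∩ (fun x => x w.length) ⁻¹' {ε} := by
  ext x
  simp only [Set.mem_inter_iff, Set.mem_preimage, mem_cylinder_iff, Set.mem_singleton_iff]
  constructor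
  · intro h
    refine ⟨fun i hi => ?_, ?_⟩
    · rw [h i (by simp; omega), List.getElem_append_left]
    · rw [h _ (by simp)]; simp
  · rintro ⟨h, h0⟩ i hi
    rw [List.length_append, List.length_singleton, Nat.lt_succ_iff_lt_or_eq] at hi
    rcases hi with hi | rfl
    · rw [h i hi, List.getElem_append_left]
    · rw [h0]; simp

lemma isClopen_cylinder (w : List (Fin 2)) : IsClopen (cylinder w) := by
  simp only [cylinder, Set.ofPred_forall]
  exact isClopen_iInter_of_finite fun i =>
    (isClopen_discrete {w.get i}).preimage (continuous_apply (i : ℕ))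

lemma measurableSet_cylinder (w : List (Fin 2)) : MeasurableSet (cylinder w) :=
  (isClopen_cylinder w).isOpen.measurableSet

lemma measurable_shift : Measurable shift :=
  measurable_pi_lambda _ fun n => measurable_pi_apply (n + 1)

lemma measurable_firstLetter : Measurable firstLetter :=
  measurable_pi_apply 0

lemma itinerary_shift_firstLetter (n : ℕ) (x : Seq) :
    itinerary shift firstLetter n x = fun i : Fin n => x i := by
  induction n generalizing x with
  | zero => exact Subsingleton.elim _ _
  | succ n ih =>
    rw [itinerary_succ_eq_cons, ih]
    ext i
    cases i using Fin.cases <;> rfl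

lemma itinerary_preimage_singleton {n : ℕ} (v : Fin n → Fin 2) :
    itinerary shift firstLetter n ⁻¹' {v} = cylinder (List.ofFn v) := by
  ext x
  simp only [Set.mem_preimage, itinerary_shift_firstLetter, Set.mem_singleton_iff,
    mem_cylinder_iff, List.getElem_ofFn, List.length_ofFn, funext_iff]
  exact Fin.forall_iff

lemma generateFrom_itineraryEvents_firstLetter :
    (inferInstance : MeasurableSpace Seq) =
      MeasurableSpace.generateFrom (itineraryEvents shift firstLetter) := by
  refine le_antisymm (iSup_le fun n => ?_) (MeasurableSpace.generateFrom_le ?_)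
  · rintro _ ⟨s, -, rfl⟩
    refine MeasurableSpace.measurableSet_generateFrom ⟨n + 1, {v | v (Fin.last n) ∈ s}, ?_⟩
    ext x
    simp [itinerary_shift_firstLetter]
  · rintro _ ⟨n, S, rfl⟩
    exact measurable_itinerary measurable_shift measurable_firstLetter n S.toFinite.measurableSet

lemma zeros_concat_zero (n : ℕ) : zeros n ++ [0] = zeros (n + 1) := by
  rw [zeros, zeros, List.replicate_succ']

lemma zero_cons_zeros (n : ℕ) : 0 :: zeros n = zeros (n + 1) := by
  rw [zeros, zeros, List.replicate_succ]

lemma ofFn_zero (n : ℕ) : List.ofFn (0 : Fin n → Fin 2) = zeros n :=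
  List.ofFn_const n 0

lemma eq_of_length_eq_of_sum_concat {f g : List (Fin 2) → ℝ} {n : ℕ}
    (hf : ∀ w, ∑ ε, f (w ++ [ε]) = f w) (hg : ∀ w, ∑ ε, g (w ++ [ε]) = g w)
    (h : ∀ w, w.length = n → f w = g w) (w : List (Fin 2)) (hw : w.length ≤ n) :
    f w = g w := by
  obtain ⟨k, hk⟩ := Nat.exists_eq_add_of_le hw
  induction k generalizing w with
  | zero => exact h w hk.symm
  | succ k ih =>
    rw [← hf, ← hg]
    exact Finset.sum_congr rfl fun ε _ => ih _ (by simp; omega) (by simp; omega)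

end Words

section Measures

variable {μ ν : Measure Seq}

lemma measureReal_cylinder_nil [IsProbabilityMeasure μ] : μ.real (cylinder []) = 1 := by
  rw [cylinder_nil, probReal_univ]

lemma sum_measureReal_cylinder_concat [IsFiniteMeasure μ] (w : List (Fin 2)) :
    ∑ ε, μ.real (cylinder (w ++ [ε])) = μ.real (cylinder w) := by
  simp_rw [cylinder_concat]
  exact (measureReal_eq_sum_inter_fiber
    (measurable_pi_apply (X := fun _ : ℕ => Fin 2) w.length) _).symm

lemma sum_measureReal_cylinder_cons [IsFiniteMeasure μ] (w : List (Fin 2)) :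
    ∑ ε, μ.real (cylinder (ε :: w)) = μ.real (shift ⁻¹' cylinder w) := by
  simp_rw [cylinder_cons]
  exact (measureReal_eq_sum_inter_fiber measurable_firstLetter _).symm

lemma ext_of_cylinder [IsFiniteMeasure μ] [IsFiniteMeasure ν]
    (h : ∀ w, μ.real (cylinder w) = ν.real (cylinder w)) : μ = ν :=
  ext_of_itinerary_generator measurable_shift measurable_firstLetter
    generateFrom_itineraryEvents_firstLetter fun n v => by
      rw [itinerary_preimage_singleton, h]

lemma measurePreserving_shift_iff [IsFiniteMeasure μ] :
    MeasurePreserving shift μ μ ↔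
      ∀ w, ∑ ε, μ.real (cylinder (ε :: w)) = μ.real (cylinder w) := by
  simp only [sum_measureReal_cylinder_cons]
  refine ⟨fun hμ w => hμ.measureReal_preimage (measurableSet_cylinder w).nullMeasurableSet,
    fun h => ⟨measurable_shift, ext_of_cylinder fun w => ?_⟩⟩
  rw [map_measureReal_apply measurable_shift (measurableSet_cylinder w), h]

end Measures

section Recursion

variable {μ ν : Measure Seq} {a : ℕ → ℝ}

lemma ZeroBlockValues.measureReal_eq (hμ : ZeroBlockValues a μ) (hν : ZeroBlockValues a ν)
    (n : ℕ) (ε ε' : Fin 2) :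
    μ.real (cylinder (ε :: (zeros n ++ [ε']))) = ν.real (cylinder (ε :: (zeros n ++ [ε']))) := by
  obtain ⟨hμ00, hμ01, hμ10, hμ11⟩ := hμ n
  obtain ⟨hν00, hν01, hν10, hν11⟩ := hν n
  fin_cases ε <;> fin_cases ε' <;> simp only [Fin.zero_eta, Fin.mk_one, *]

lemma Recursion.measureReal_eq_of_length_eq_add_two [IsFiniteMeasure μ] [IsFiniteMeasure ν]
    (hμ : Recursion μ) (hν : Recursion ν) (hμa : ZeroBlockValues a μ)
    (hνa : ZeroBlockValues a ν) (n : ℕ) (w : List (Fin 2)) (hw : w.length = n + 2) :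
    μ.real (cylinder w) = ν.real (cylinder w) := by
  induction n using Nat.strong_induction_on generalizing w with
  | _ n ih =>
    obtain ⟨ε, u, rfl⟩ := List.exists_cons_of_length_eq_add_one hw
    obtain ⟨w, ε', rfl⟩ := (List.eq_nil_or_concat' u).resolve_left (by rintro rfl; simp at hw)
    by_cases hzeros : ∃ k, w = zeros k
    · obtain ⟨k, rfl⟩ := hzeros
      exact hμa.measureReal_eq hνa k ε ε'
    simp only [List.length_cons, List.length_append, List.length_nil] at hw
    have hshorter (u : List (Fin 2)) (hu : u.length ≤ w.length + 1) :
        μ.real (cylinder u) = ν.real (cylinder u) := by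
      rcases n with _ | n
      · exact absurd ⟨0, List.length_eq_zero_iff.1 (by omega)⟩ hzeros
      · exact eq_of_length_eq_of_sum_concat sum_measureReal_cylinder_concat
          sum_measureReal_cylinder_concat (ih n n.lt_succ_self) u (by omega)
    rw [hμ w (not_exists.1 hzeros), hν w (not_exists.1 hzeros), hshorter w (by omega),
      hshorter (ε :: w) (by simp), hshorter (w ++ [ε']) (by simp)]

lemma Recursion.ext [IsFiniteMeasure μ] [IsFiniteMeasure ν] (hμ : Recursion μ)
    (hν : Recursion ν) (hμa : ZeroBlockValues a μ) (hνa : ZeroBlockValues a ν) : μ = ν :=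
  ext_of_cylinder fun w => eq_of_length_eq_of_sum_concat sum_measureReal_cylinder_concat
    sum_measureReal_cylinder_concat
    (hμ.measureReal_eq_of_length_eq_add_two hν hμa hνa w.length) w (by omega)

end Recursion

section InvMeasures

variable {μ : Measure Seq} {a : ℕ → ℝ}

lemma measureReal_cylinder_zeros (ha0 : a 0 = 1) (hμ : μ ∈ invMeasures a) (n : ℕ) :
    μ.real (cylinder (zeros n)) = a n := by
  obtain ⟨hprob, -, hzeros⟩ := hμ
  rcases n with _ | n
  · rw [ha0]
    exact measureReal_cylinder_nil
  · exact hzeros _ (Nat.le_add_left 1 n)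

lemma measureReal_cylinder_zeros_concat_one (ha0 : a 0 = 1) (hμ : μ ∈ invMeasures a) (n : ℕ) :
    μ.real (cylinder (zeros n ++ [1])) = a n - a (n + 1) := by
  have := hμ.1
  have hsum := sum_measureReal_cylinder_concat (μ := μ) (zeros n)
  rw [Fin.sum_univ_two, zeros_concat_zero, measureReal_cylinder_zeros ha0 hμ,
    measureReal_cylinder_zeros ha0 hμ] at hsum
  linarith

lemma measureReal_cylinder_one_cons_zeros (ha0 : a 0 = 1) (hμ : μ ∈ invMeasures a) (n : ℕ) :
    μ.real (cylinder (1 :: zeros n)) = a n - a (n + 1) := by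
  have := hμ.1
  have hsum := measurePreserving_shift_iff.1 hμ.2.1 (zeros n)
  rw [Fin.sum_univ_two, zero_cons_zeros, measureReal_cylinder_zeros ha0 hμ,
    measureReal_cylinder_zeros ha0 hμ] at hsum
  linarith

lemma zeroBlockValues_of_mem_invMeasures (ha0 : a 0 = 1) (hμ : μ ∈ invMeasures a) :
    ZeroBlockValues a μ := by
  intro n
  have := hμ.1
  have h01 : μ.real (cylinder (0 :: (zeros n ++ [1]))) = a (n + 1) - a (n + 2) := by
    rw [← List.cons_append, zero_cons_zeros, measureReal_cylinder_zeros_concat_one ha0 hμ]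
  refine ⟨?_, h01, ?_, ?_⟩
  · rw [zeros_concat_zero, zero_cons_zeros, measureReal_cylinder_zeros ha0 hμ]
  · rw [zeros_concat_zero, measureReal_cylinder_one_cons_zeros ha0 hμ]
  · have hsum := measurePreserving_shift_iff.1 hμ.2.1 (zeros n ++ [1])
    rw [Fin.sum_univ_two, measureReal_cylinder_zeros_concat_one ha0 hμ, h01] at hsum
    linarith

end InvMeasures

section EntropyFormula

variable {μ : Measure Seq}

/-- The mutual information of the two letters surrounding the word `w`, conditioned on `w` and
weighted by its probability. -/
noncomputable def wordMutualInfo (μ : Measure Seq) (w : List (Fin 2)) : ℝ :=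
  mutualInfo fun ε ε' : Fin 2 => μ.real (cylinder (ε :: (w ++ [ε'])))

lemma wordMutualInfo_nonneg (w : List (Fin 2)) : 0 ≤ wordMutualInfo μ w :=
  mutualInfo_nonneg fun _ _ => measureReal_nonneg

/-- The mutual information carried by all words of length `n` other than `0^n`. It is the loss in
the `n`-th entropy increment caused by the failure of the recursion at these words. -/
noncomputable def entropyDefect (μ : Measure Seq) (n : ℕ) : ℝ :=
  ∑ v : Fin n → Fin 2 with v ≠ 0, wordMutualInfo μ (List.ofFn v)

lemma entropyDefect_nonneg (n : ℕ) : 0 ≤ entropyDefect μ n :=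
  Finset.sum_nonneg fun _ _ => wordMutualInfo_nonneg _

lemma sum_wordMutualInfo (n : ℕ) :
    ∑ v : Fin n → Fin 2, wordMutualInfo μ (List.ofFn v) =
      wordMutualInfo μ (zeros n) + entropyDefect μ n := by
  rw [entropyDefect, Finset.filter_ne', ← ofFn_zero]
  exact (Finset.add_sum_erase _ (fun v => wordMutualInfo μ (List.ofFn v)) (Finset.mem_univ 0)).symm

section Invariant

variable [IsFiniteMeasure μ]

lemma sum_measureReal_cylinder_cons_concat (ε : Fin 2) (w : List (Fin 2)) :
    ∑ ε', μ.real (cylinder (ε :: (w ++ [ε']))) = μ.real (cylinder (ε :: w)) :=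
  sum_measureReal_cylinder_concat (ε :: w)

lemma wordMutualInfo_eq (hμ : MeasurePreserving shift μ μ) (w : List (Fin 2)) :
    wordMutualInfo μ w = ∑ ε, negMulLog (μ.real (cylinder (ε :: w))) +
      ∑ ε, negMulLog (μ.real (cylinder (w ++ [ε]))) -
      ∑ ε, ∑ ε', negMulLog (μ.real (cylinder (ε :: (w ++ [ε'])))) -
      negMulLog (μ.real (cylinder w)) := by
  simp only [wordMutualInfo, mutualInfo, sum_measureReal_cylinder_cons_concat,
    measurePreserving_shift_iff.1 hμ]

lemma wordMutualInfo_eq_zero_iff (hμ : MeasurePreserving shift μ μ) (w : List (Fin 2)) :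
    wordMutualInfo μ w = 0 ↔ ∀ ε ε' : Fin 2, μ.real (cylinder (ε :: (w ++ [ε']))) =
      μ.real (cylinder (ε :: w)) * μ.real (cylinder (w ++ [ε'])) / μ.real (cylinder w) := by
  rw [wordMutualInfo, mutualInfo_eq_zero_iff fun _ _ => measureReal_nonneg]
  simp only [marginalProduct, sum_measureReal_cylinder_cons_concat,
    measurePreserving_shift_iff.1 hμ]

lemma forall_entropyDefect_eq_zero_iff (hμ : MeasurePreserving shift μ μ) :
    (∀ n, entropyDefect μ n = 0) ↔ Recursion μ := by
  simp only [entropyDefect, Finset.sum_eq_zero_iff_of_nonneg fun _ _ => wordMutualInfo_nonneg _,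
    Finset.mem_filter_univ, wordMutualInfo_eq_zero_iff hμ, Recursion]
  constructor
  · intro h w hw
    have hget : w.get ≠ 0 := fun hget => hw w.length (by rw [← ofFn_zero, ← hget, List.ofFn_get])
    simpa only [List.ofFn_get] using h w.length w.get hget
  · refine fun h n v hv => h _ fun k hk => hv ?_
    obtain rfl : n = k := by simpa [zeros] using congrArg List.length hk
    exact List.ofFn_injective (hk.trans (ofFn_zero n).symm)

lemma itineraryEntropy_shift_second_difference (hμ : MeasurePreserving shift μ μ) (n : ℕ) :
    2 * itineraryEntropy shift μ firstLetter (n + 1)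
        - itineraryEntropy shift μ firstLetter (n + 2) - itineraryEntropy shift μ firstLetter n =
      wordMutualInfo μ (zeros n) + entropyDefect μ n := by
  rw [itineraryEntropy_second_difference hμ measurable_firstLetter, ← sum_wordMutualInfo]
  refine Finset.sum_congr rfl fun v _ => congrArg _ (funext₂ fun ε ε' => ?_)
  rw [itinerary_preimage_singleton, List.ofFn_cons, List.ofFn_succ']
  simp only [Fin.snoc_castSucc, Fin.snoc_last, List.concat_eq_append]

end Invariant

lemma itineraryEntropy_shift_eq_sum (n : ℕ) :
    itineraryEntropy shift μ firstLetter n =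
      ∑ v : Fin n → Fin 2, negMulLog (μ.real (cylinder (List.ofFn v))) := by
  simp only [itineraryEntropy, partitionEntropy, itinerary_preimage_singleton]

variable {a : ℕ → ℝ}

/-- The part of the `n`-th entropy increment that depends on `a n` and `a (n + 1)` only. It tends
to `0`, so it does not contribute to the entropy. -/
noncomputable def boundaryTerm (a : ℕ → ℝ) (n : ℕ) : ℝ :=
  negMulLog (a (n + 1)) - negMulLog (a n) + 2 * negMulLog (a n - a (n + 1))

lemma tendsto_boundaryTerm {l : ℝ} (ha : Tendsto a atTop (𝓝 l)) :
    Tendsto (boundaryTerm a) atTop (𝓝 0) := by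
  have ha' := ha.comp (tendsto_add_atTop_nat 1)
  have hcont := continuous_negMulLog.tendsto
  have hlim := (((hcont l).comp ha').sub ((hcont l).comp ha)).add
    (((hcont (l - l)).comp (ha.sub ha')).const_mul 2)
  simp only [sub_self, negMulLog_zero, mul_zero, add_zero] at hlim
  exact hlim

lemma wordMutualInfo_zeros (ha0 : a 0 = 1) (hμ : μ ∈ invMeasures a) (n : ℕ) :
    wordMutualInfo μ (zeros n) = boundaryTerm a n - boundaryTerm a (n + 1)
      - negMulLog (a n - 2 * a (n + 1) + a (n + 2)) := by
  have := hμ.1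
  obtain ⟨-, h01, -, h11⟩ := zeroBlockValues_of_mem_invMeasures ha0 hμ n
  rw [wordMutualInfo_eq hμ.2.1]
  simp only [Fin.sum_univ_two, h01, h11, zero_cons_zeros, zeros_concat_zero,
    measureReal_cylinder_zeros ha0 hμ, measureReal_cylinder_one_cons_zeros ha0 hμ,
    measureReal_cylinder_zeros_concat_one ha0 hμ, boundaryTerm]
  ring

lemma itineraryEntropy_shift_one_sub_zero (ha0 : a 0 = 1) (hμ : μ ∈ invMeasures a) :
    itineraryEntropy shift μ firstLetter 1 - itineraryEntropy shift μ firstLetter 0 =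
      -negMulLog (1 - a 1) + boundaryTerm a 0 := by
  have := hμ.1
  have hletter0 := measureReal_cylinder_zeros ha0 hμ 1
  have hletter1 := measureReal_cylinder_zeros_concat_one ha0 hμ 0
  simp only [zeros, List.replicate_one, List.replicate_zero, List.nil_append, zero_add, ha0]
    at hletter0 hletter1
  rw [itineraryEntropy_shift_eq_sum, itineraryEntropy_shift_eq_sum,
    ← (Equiv.funUnique (Fin 1) (Fin 2)).symm.sum_comp]
  simp only [Equiv.funUnique_symm_apply, List.ofFn_succ, List.ofFn_zero, uniqueElim_const,
    Fin.sum_univ_two, hletter0, hletter1, Finset.univ_unique, Finset.sum_const_zero,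
    measureReal_cylinder_nil, negMulLog_one, sub_zero, boundaryTerm, zero_add, ha0]
  ring

lemma itineraryEntropy_shift_increment (ha0 : a 0 = 1) (hμ : μ ∈ invMeasures a) (N : ℕ) :
    itineraryEntropy shift μ firstLetter (N + 1) - itineraryEntropy shift μ firstLetter N =
      -negMulLog (1 - a 1) + boundaryTerm a N
        + ∑ j ∈ Finset.range N, negMulLog (a j - 2 * a (j + 1) + a (j + 2))
        - ∑ j ∈ Finset.range N, entropyDefect μ j := by
  have := hμ.1
  induction N with
  | zero => simpa using itineraryEntropy_shift_one_sub_zero ha0 hμ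
  | succ N ih =>
    have hdiff := itineraryEntropy_shift_second_difference hμ.2.1 N
    rw [wordMutualInfo_zeros ha0 hμ] at hdiff
    rw [Finset.sum_range_succ, Finset.sum_range_succ]
    linarith

lemma antitone_of_mem_invMeasures (ha0 : a 0 = 1) (hμ : μ ∈ invMeasures a) : Antitone a :=
  antitone_nat_of_succ_le fun n => sub_nonneg.1 <| by
    rw [← measureReal_cylinder_zeros_concat_one ha0 hμ]
    exact measureReal_nonneg

lemma tendsto_boundaryTerm_of_mem_invMeasures (ha0 : a 0 = 1) (hμ : μ ∈ invMeasures a) :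
    Tendsto (boundaryTerm a) atTop (𝓝 0) :=
  tendsto_boundaryTerm <| tendsto_atTop_ciInf (antitone_of_mem_invMeasures ha0 hμ)
    ⟨0, Set.forall_mem_range.2 fun n => by
      rw [← measureReal_cylinder_zeros ha0 hμ]
      exact measureReal_nonneg⟩

lemma negMulLog_second_difference_nonneg (ha0 : a 0 = 1) (hμ : μ ∈ invMeasures a) (n : ℕ) :
    0 ≤ negMulLog (a n - 2 * a (n + 1) + a (n + 2)) := by
  have := hμ.1
  rw [← (zeroBlockValues_of_mem_invMeasures ha0 hμ n).2.2.2]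
  exact negMulLog_nonneg measureReal_nonneg measureReal_le_one

lemma summable_negMulLog_second_difference (ha0 : a 0 = 1) (hμ : μ ∈ invMeasures a)
    (hrec : Recursion μ) :
    Summable fun j => negMulLog (a j - 2 * a (j + 1) + a (j + 2)) := by
  have := hμ.1
  obtain ⟨B, hB⟩ := (tendsto_boundaryTerm_of_mem_invMeasures ha0 hμ).bddBelow_range
  refine summable_of_sum_range_le (negMulLog_second_difference_nonneg ha0 hμ)
    (c := boundaryTerm a 0 - B) fun N => ?_
  have hincrement := itineraryEntropy_shift_increment ha0 hμ N
  rw [Finset.sum_eq_zero fun j _ => (forall_entropyDefect_eq_zero_iff hμ.2.1).2 hrec j]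
    at hincrement
  have hle := antitone_itineraryEntropy_increment hμ.2.1 measurable_firstLetter N.zero_le
  simp only [zero_add, itineraryEntropy_shift_one_sub_zero ha0 hμ] at hle
  linarith [hB ⟨N, rfl⟩]

variable {S : ℝ}

lemma summable_entropyDefect (ha0 : a 0 = 1) (hμ : μ ∈ invMeasures a)
    (hS : HasSum (fun j => negMulLog (a j - 2 * a (j + 1) + a (j + 2))) S) :
    Summable (entropyDefect μ) := by
  have := hμ.1
  obtain ⟨B, hB⟩ := (tendsto_boundaryTerm_of_mem_invMeasures ha0 hμ).bddAbove_range
  refine summable_of_sum_range_le entropyDefect_nonneg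
    (c := -negMulLog (1 - a 1) + B + S) fun N => ?_
  have hpartial := sum_le_hasSum (Finset.range N)
    (fun j _ => negMulLog_second_difference_nonneg ha0 hμ j) hS
  have hmono := itineraryEntropy_le_succ (μ := μ) measurable_shift measurable_firstLetter N
  linarith [itineraryEntropy_shift_increment ha0 hμ N, hB ⟨N, rfl⟩]

lemma ksEntropy_shift_eq_sub_tsum (ha0 : a 0 = 1) (hμ : μ ∈ invMeasures a)
    (hS : HasSum (fun j => negMulLog (a j - 2 * a (j + 1) + a (j + 2))) S) :
    ksEntropy shift μ = ((-negMulLog (1 - a 1) + S - ∑' n, entropyDefect μ n : ℝ) : EReal) := by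
  have := hμ.1
  refine ksEntropy_eq_of_generator generateFrom_itineraryEvents_firstLetter hμ.2.1
    measurable_firstLetter ?_
  have hlim := (((tendsto_boundaryTerm_of_mem_invMeasures ha0 hμ).const_add
    (-negMulLog (1 - a 1))).add hS.tendsto_sum_nat).sub
    (summable_entropyDefect ha0 hμ hS).hasSum.tendsto_sum_nat
  rw [add_zero] at hlim
  exact hlim.congr fun N => (itineraryEntropy_shift_increment ha0 hμ N).symm

lemma ksEntropy_shift_eq_of_recursion (ha0 : a 0 = 1) (hμ : μ ∈ invMeasures a)
    (hS : HasSum (fun j => negMulLog (a j - 2 * a (j + 1) + a (j + 2))) S)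
    (hrec : Recursion μ) :
    ksEntropy shift μ = ((-negMulLog (1 - a 1) + S : ℝ) : EReal) := by
  have := hμ.1
  rw [ksEntropy_shift_eq_sub_tsum ha0 hμ hS,
    funext ((forall_entropyDefect_eq_zero_iff hμ.2.1).2 hrec), tsum_zero, sub_zero]

lemma ksEntropy_shift_le (ha0 : a 0 = 1) (hμ : μ ∈ invMeasures a)
    (hS : HasSum (fun j => negMulLog (a j - 2 * a (j + 1) + a (j + 2))) S) :
    ksEntropy shift μ ≤ ((-negMulLog (1 - a 1) + S : ℝ) : EReal) := by
  rw [ksEntropy_shift_eq_sub_tsum ha0 hμ hS, EReal.coe_le_coe_iff, sub_le_self_iff]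
  exact tsum_nonneg entropyDefect_nonneg

lemma recursion_of_ksEntropy_shift_eq (ha0 : a 0 = 1) (hμ : μ ∈ invMeasures a)
    (hS : HasSum (fun j => negMulLog (a j - 2 * a (j + 1) + a (j + 2))) S)
    (h : ksEntropy shift μ = ((-negMulLog (1 - a 1) + S : ℝ) : EReal)) : Recursion μ := by
  have := hμ.1
  rw [ksEntropy_shift_eq_sub_tsum ha0 hμ hS, EReal.coe_eq_coe_iff, sub_eq_self] at h
  have hdefect := (summable_entropyDefect ha0 hμ hS).hasSum
  rw [h, hasSum_zero_iff_of_nonneg entropyDefect_nonneg] at hdefect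
  exact (forall_entropyDefect_eq_zero_iff hμ.2.1).1 (congrFun hdefect)

end EntropyFormula

section Realization

lemma exists_probabilityMeasure_fiber {Ω ι : Type*} [MeasurableSpace Ω] [Fintype ι]
    [MeasurableSpace ι] [MeasurableSingletonClass ι] {X : Ω → ι} (hX : Measurable X)
    (hsurj : Function.Surjective X) {q : ι → ℝ} (hq : ∀ i, 0 ≤ q i) (hsum : ∑ i, q i = 1) :
    ∃ μ : ProbabilityMeasure Ω, ∀ i, (μ : Measure Ω).real (X ⁻¹' {i}) = q i := by
  let law : PMF ι := PMF.ofFintype (fun i => ENNReal.ofReal (q i)) <| by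
    rw [← ENNReal.ofReal_sum_of_nonneg fun i _ => hq i, hsum, ENNReal.ofReal_one]
  have hsection : Measurable (Function.surjInv hsurj) := Measurable.of_discrete
  refine ⟨⟨law.toMeasure.map (Function.surjInv hsurj),
    Measure.isProbabilityMeasure_map hsection.aemeasurable⟩, fun i => ?_⟩
  have hpoint : Function.surjInv hsurj ⁻¹' (X ⁻¹' {i}) = {i} := by
    ext j
    simp [Function.surjInv_eq hsurj j]
  rw [ProbabilityMeasure.coe_mk,
    map_measureReal_apply hsection (hX (measurableSet_singleton i)), hpoint, Measure.real,
    PMF.toMeasure_apply_singleton _ _ (measurableSet_singleton i), PMF.ofFintype_apply,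
    ENNReal.toReal_ofReal (hq i)]

lemma exists_probabilityMeasure_of_eventually_eq {Ω κ δ : Type*} [TopologicalSpace Ω]
    [CompactSpace Ω] [T2Space Ω] [HasOuterApproxClosed Ω] [MeasurableSpace Ω] [BorelSpace Ω]
    {E : κ → Set Ω} (hE : ∀ k, IsClopen (E k)) {p : κ → ℝ} {l : Filter δ} [l.NeBot]
    (P : δ → ProbabilityMeasure Ω)
    (hP : ∀ k, ∀ᶠ d in l, (P d : Measure Ω).real (E k) = p k) :
    ∃ μ : ProbabilityMeasure Ω, ∀ k, (μ : Measure Ω).real (E k) = p k := by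
  obtain ⟨μ, -, hμ⟩ := isCompact_univ.ultrafilter_le_nhds ((Ultrafilter.of l).map P) (by simp)
  refine ⟨μ, fun k => tendsto_nhds_unique ?_
    ((tendsto_congr' ((hP k).filter_mono (Ultrafilter.of_le l))).2 tendsto_const_nhds)⟩
  exact (NNReal.continuous_coe.tendsto _).comp
    (ProbabilityMeasure.tendsto_measure_of_isClopen_of_tendsto hμ (hE k))

lemma surjective_itinerary_shift (n : ℕ) :
    Function.Surjective (itinerary shift firstLetter n) := by
  refine fun v => ⟨fun i => if h : i < n then v ⟨i, h⟩ else 0, ?_⟩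
  rw [itinerary_shift_firstLetter]
  ext i
  simp

lemma sum_ofFn_succ (p : List (Fin 2) → ℝ) (n : ℕ) :
    ∑ v : Fin (n + 1) → Fin 2, p (List.ofFn v) =
      ∑ v : Fin n → Fin 2, ∑ ε, p (List.ofFn v ++ [ε]) := by
  rw [← (Fin.snocEquiv fun _ => Fin 2).sum_comp, Fintype.sum_prod_type_right]
  simp only [Fin.snocEquiv, Equiv.coe_fn_mk, List.ofFn_succ', Fin.snoc_castSucc, Fin.snoc_last,
    List.concat_eq_append]

lemma exists_probabilityMeasure_cylinder {p : List (Fin 2) → ℝ} (hp : ∀ w, 0 ≤ p w)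
    (hnil : p [] = 1) (hsum : ∀ w, ∑ ε, p (w ++ [ε]) = p w) :
    ∃ μ : ProbabilityMeasure Seq, ∀ w, (μ : Measure Seq).real (cylinder w) = p w := by
  have htotal (n : ℕ) : ∑ v : Fin n → Fin 2, p (List.ofFn v) = 1 := by
    induction n with
    | zero => simpa using hnil
    | succ n ih => simp only [sum_ofFn_succ, hsum, ih]
  choose P hP using fun n => exists_probabilityMeasure_fiber
    (measurable_itinerary measurable_shift measurable_firstLetter n)
    (surjective_itinerary_shift n) (fun v => hp (List.ofFn v)) (htotal n)
  refine exists_probabilityMeasure_of_eventually_eq isClopen_cylinder (l := atTop) P fun w => ?_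
  filter_upwards [eventually_ge_atTop w.length] with n hn
  refine eq_of_length_eq_of_sum_concat (f := fun w => (P n : Measure Seq).real (cylinder w))
    sum_measureReal_cylinder_concat hsum ?_ w hn
  rintro u rfl
  simpa only [itinerary_preimage_singleton, List.ofFn_get] using hP u.length u.get

end Realization

section Renewal

/-- The weight of a word under a renewal process whose renewals are the letters `1`: `f n` is the
probability that a renewal is followed by `n` zeros, and `s n` the weight of starting with `n`
zeros. -/
noncomputable def renewalWeight (f : ℕ → ℝ) : (ℕ → ℝ) → List (Fin 2) → ℝ
  | s, [] => s 0
  | s, 0 :: w => renewalWeight f (fun n => s (n + 1)) w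
  | s, 1 :: w => (s 0 - s 1) * renewalWeight f f w

variable {f s : ℕ → ℝ}

lemma renewalWeight_nonneg (hf : ∀ n, 0 ≤ f n) (hf' : Antitone f) (hs : ∀ n, 0 ≤ s n)
    (hs' : Antitone s) (w : List (Fin 2)) : 0 ≤ renewalWeight f s w := by
  induction w generalizing s with
  | nil => exact hs 0
  | cons ε w ih =>
    match ε with
    | 0 => exact ih (fun n => hs (n + 1)) fun m n hmn => hs' (by omega)
    | 1 => exact mul_nonneg (sub_nonneg.2 (hs' zero_le_one)) (ih hf hf')

lemma sum_renewalWeight_concat (hf : f 0 = 1) (s : ℕ → ℝ) (w : List (Fin 2)) :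
    ∑ ε, renewalWeight f s (w ++ [ε]) = renewalWeight f s w := by
  induction w generalizing s with
  | nil => simp [renewalWeight, hf]
  | cons ε w ih =>
    match ε with
    | 0 => exact ih _
    | 1 => simp only [List.cons_append, renewalWeight, ← Finset.mul_sum, ih]

lemma renewalWeight_eq_add_mul {r t : ℕ → ℝ} {c : ℝ} (h : ∀ n, s n = t n + c * r n)
    (w : List (Fin 2)) :
    renewalWeight f s w = renewalWeight f t w + c * renewalWeight f r w := by
  induction w generalizing r s t with
  | nil => exact h 0
  | cons ε w ih =>
    match ε with
    | 0 => exact ih fun n => h (n + 1)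
    | 1 =>
      simp only [renewalWeight, h]
      ring

lemma sum_renewalWeight_cons (h : ∀ n, s n - s (n + 1) = (s 0 - s 1) * f n)
    (w : List (Fin 2)) : ∑ ε, renewalWeight f s (ε :: w) = renewalWeight f s w := by
  rw [Fin.sum_univ_two]
  exact (renewalWeight_eq_add_mul (fun n => by rw [← h]; ring) w).symm

lemma renewalWeight_zeros_append (n : ℕ) (w : List (Fin 2)) :
    renewalWeight f s (zeros n ++ w) = renewalWeight f (fun k => s (k + n)) w := by
  induction n generalizing s with
  | zero => rfl
  | succ n ih =>
    rw [← zero_cons_zeros, List.cons_append, renewalWeight, ih]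
    simp only [add_assoc]

lemma renewalWeight_zeros (n : ℕ) : renewalWeight f s (zeros n) = s n := by
  rw [← List.append_nil (zeros n), renewalWeight_zeros_append, renewalWeight, zero_add]

lemma renewalWeight_zeros_append_one_cons (n : ℕ) (u : List (Fin 2)) :
    renewalWeight f s (zeros n ++ 1 :: u) = (s n - s (n + 1)) * renewalWeight f f u := by
  rw [renewalWeight_zeros_append, renewalWeight, zero_add, add_comm 1 n]

lemma exists_eq_zeros_append_one_cons {w : List (Fin 2)} (hw : ∀ n, w ≠ zeros n) :
    ∃ n u, w = zeros n ++ 1 :: u := by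
  induction w with
  | nil => exact absurd rfl (hw 0)
  | cons ε w ih =>
    match ε with
    | 0 =>
      obtain ⟨n, u, rfl⟩ := ih fun n hn => hw (n + 1) (by rw [hn, zero_cons_zeros])
      exact ⟨n + 1, u, by rw [← zero_cons_zeros, List.cons_append]⟩
    | 1 => exact ⟨0, w, rfl⟩

lemma renewalWeight_cons_concat_mul {w : List (Fin 2)} (hw : ∀ n, w ≠ zeros n) (ε ε' : Fin 2) :
    renewalWeight f s (ε :: (w ++ [ε'])) * renewalWeight f s w =
      renewalWeight f s (ε :: w) * renewalWeight f s (w ++ [ε']) := by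
  obtain ⟨n, u, rfl⟩ := exists_eq_zeros_append_one_cons hw
  match ε with
  | 0 | 1 =>
    simp only [List.append_assoc, List.cons_append, renewalWeight,
      renewalWeight_zeros_append_one_cons]
    ring

lemma recursion_of_mul_eq_mul {μ : Measure Seq} [IsFiniteMeasure μ]
    (hμ : MeasurePreserving shift μ μ)
    (h : ∀ w, (∀ n, w ≠ zeros n) → ∀ ε ε' : Fin 2,
      μ.real (cylinder (ε :: (w ++ [ε']))) * μ.real (cylinder w) =
        μ.real (cylinder (ε :: w)) * μ.real (cylinder (w ++ [ε']))) :
    Recursion μ := by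
  intro w hw ε ε'
  rcases eq_or_ne (μ.real (cylinder w)) 0 with hnull | hpos
  · have hsub : cylinder (ε :: (w ++ [ε'])) ⊆ shift ⁻¹' cylinder w := by
      rw [cylinder_cons, cylinder_concat]
      exact fun x hx => hx.1.1
    have hle := measureReal_mono (μ := μ) hsub
    rw [hμ.measureReal_preimage (measurableSet_cylinder w).nullMeasurableSet, hnull] at hle
    rw [hnull, div_zero, measureReal_nonneg.antisymm' hle]
  · exact eq_div_of_mul_eq hpos (h w hw ε ε')

lemma exists_antitone_normalization {d : ℕ → ℝ} (hd : ∀ n, 0 ≤ d n) (hd' : Antitone d) :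
    ∃ f : ℕ → ℝ, f 0 = 1 ∧ (∀ n, 0 ≤ f n) ∧ Antitone f ∧ ∀ n, d n = d 0 * f n := by
  rcases eq_or_ne (d 0) 0 with h0 | h0
  · refine ⟨fun _ => 1, rfl, fun _ => zero_le_one, antitone_const, fun n => ?_⟩
    rw [h0, zero_mul]
    exact (h0 ▸ hd' n.zero_le).antisymm (hd n)
  · exact ⟨fun n => d n / d 0, div_self h0, fun n => div_nonneg (hd n) (hd 0),
      fun m n hmn => div_le_div_of_nonneg_right (hd' hmn) (hd 0),
      fun n => (mul_div_cancel₀ (d n) h0).symm⟩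

lemma exists_mem_invMeasures_recursion {a : ℕ → ℝ} (ha0 : a 0 = 1) (hnonneg : ∀ n, 0 ≤ a n)
    (hanti : Antitone a) (hconv : Antitone fun n => a n - a (n + 1)) :
    ∃ μ ∈ invMeasures a, Recursion μ := by
  obtain ⟨f, hf0, hf, hf', hfa⟩ :=
    exists_antitone_normalization (fun n => sub_nonneg.2 (hanti n.le_succ)) hconv
  obtain ⟨μ, hμ⟩ := exists_probabilityMeasure_cylinder
    (renewalWeight_nonneg hf hf' hnonneg hanti) ha0 (sum_renewalWeight_concat hf0 a)
  have hinv : MeasurePreserving shift (μ : Measure Seq) μ :=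
    measurePreserving_shift_iff.2 fun w => by simp only [hμ, sum_renewalWeight_cons hfa]
  refine ⟨μ, ⟨inferInstance, hinv, fun n _ => by rw [hμ, renewalWeight_zeros]⟩,
    recursion_of_mul_eq_mul hinv fun w hw ε ε' => ?_⟩
  simp only [hμ, renewalWeight_cons_concat_mul hw]

end Renewal

end ZeroBlocks

theorem mainTheorem8 (a : ℕ → ℝ) (ha0 : a 0 = 1) (hnonneg : ∀ n, 0 ≤ a n)
    (hmono : ∀ n, a (n + 1) ≤ a n)
    (hconv : ∀ i, 0 ≤ a i - 2 * a (i + 1) + a (i + 2)) :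
    ∃ μ : Measure ZeroBlocks.Seq,
      μ ∈ ZeroBlocks.invMeasures a ∧
      ZeroBlocks.Recursion μ ∧
      ZeroBlocks.ZeroBlockValues a μ ∧
      (∀ ν : Measure ZeroBlocks.Seq, IsProbabilityMeasure ν →
        ZeroBlocks.Recursion ν → ZeroBlocks.ZeroBlockValues a ν → ν = μ) ∧
      (∀ ν ∈ ZeroBlocks.invMeasures a,
        ZeroBlocks.ksEntropy ZeroBlocks.shift ν ≤ ZeroBlocks.ksEntropy ZeroBlocks.shift μ) ∧
      (∀ ν ∈ ZeroBlocks.invMeasures a,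
        ZeroBlocks.ksEntropy ZeroBlocks.shift ν = ZeroBlocks.ksEntropy ZeroBlocks.shift μ →
          ν = μ) ∧
      ∃ S : ℝ,
        HasSum (fun j : ℕ => Real.negMulLog (a j - 2 * a (j + 1) + a (j + 2))) S ∧
        ZeroBlocks.ksEntropy ZeroBlocks.shift μ =
          ((-Real.negMulLog (1 - a 1) + S : ℝ) : EReal) := by
  open ZeroBlocks in
  have hanti : Antitone a := antitone_nat_of_succ_le hmono
  have hconvex : Antitone fun i => a i - a (i + 1) :=
    antitone_nat_of_succ_le fun i => by linarith [hconv i]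
  obtain ⟨μ, hμ, hrec⟩ := exists_mem_invMeasures_recursion ha0 hnonneg hanti hconvex
  have hval := zeroBlockValues_of_mem_invMeasures ha0 hμ
  have := hμ.1
  obtain ⟨S, hS⟩ := summable_negMulLog_second_difference ha0 hμ hrec
  have hent := ksEntropy_shift_eq_of_recursion ha0 hμ hS hrec
  refine ⟨μ, hμ, hrec, hval, fun ν _ hνrec hνval => hνrec.ext hrec hνval hval,
    fun ν hν => (ksEntropy_shift_le ha0 hν hS).trans_eq hent.symm, fun ν hν h => ?_, S, hS, hent⟩
  have := hν.1
  have hνrec := recursion_of_ksEntropy_shift_eq ha0 hν hS (h.trans hent)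
  exact hνrec.ext hrec (zeroBlockValues_of_mem_invMeasures ha0 hν) hval
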